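/- Let $Q^{(1)}=A_1B_1C_1D_1$ be a quadrilateral in the plane (convex, concave or self-intersecting), no three of whose vertices are collinear and whose four vertices do not lie on one circle. For a quadrilateral $ABCD$ its triad circles are the circumcircles $o_1=(DAB)$, $o_2=(ABC)$, $o_3=(BCD)$, $o_4=(CDA)$. Let $Q^{(n+1)}=A_{n+1}B_{n+1}C_{n+1}D_{n+1}$ be the quadrilateral whose vertices are, in this order, the centers of the triad circles $o_1^{(n)},o_2^{(n)},o_3^{(n)},o_4^{(n)}$ of $Q^{(n)}$ ($n\ge 1$). For circles $o,o'$ with centers $O,O'$ and radii $R,R'$, the circle of similitude $CS(o,o')$ is the set of points $P$ with $|PO|/|PO'|=R/R'$; the point $\infty$ is counted as belonging to it exactly when $R=R'$. A spiral similarity centered at a point $w$ of the plane is a map $z\mapsto w+c(z-w)$ with $c\in\mathbb C\setminus\{0\}$; a spiral similarity centered at $\infty$ means a translation. Then every $Q^{(n)}$ again has no three collinear vertices and is not cyclic, and in the plane extended by $\infty$ the circles of similitude $CS(o_1^{(1)},o_2^{(1)})$ and $CS(o_1^{(1)},o_4^{(1)})$ have exactly one common point $W$ different from $A_1$. A point $w$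 of the plane equals $W$ if and only if it is the common center of the similarities of the iterative process, that is, there is a real $r\neq 1$ such that for all $n\ge1$ the map $z\mapsto w+r(z-w)$ takes the vertices of $Q^{(n)}$ to the corresponding vertices of $Q^{(n+2)}$. Moreover, for all $i,j\in\{1,2,3,4\}$ and all generations $k,l\ge 1$, $$W\in CS\bigl(o_i^{(k)},o_j^{(l)}\bigr),$$ and there is a spiral similarity centered at $W$ that takes $o_i^{(k)}$ onto $o_j^{(l)}$. -/

import Mathlib

/-- The three vertices `Q (i-1)`, `Q i`, `Q (i+1)` (indices mod 4) of the `i`-th triad triangle of the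
quadrilateral with consecutive vertices `A = Q 0`, `B = Q 1`, `C = Q 2`, `D = Q 3`. -/
def triad (Q : Fin 4 → ℂ) (i : Fin 4) : Fin 3 → ℂ :=
  ![Q (i - 1), Q i, Q (i + 1)]

/-- Four points of the plane, no three of them collinear and not all four on one circle.  The
quadrilateral `ABCD` may be convex, concave or self-intersecting. -/
def IsNoncyclicQuadrilateral (Q : Fin 4 → ℂ) : Prop :=
  (∀ i, AffineIndependent ℝ (triad Q i)) ∧ ¬ EuclideanGeometry.Cospherical (Set.range Q)

open Classical in
/-- The `i`-th triad circle: the circumcircle of the `i`-th triad triangle, so that `o₁ = (DAB)`,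
`o₂ = (ABC)`, `o₃ = (BCD)`, `o₄ = (CDA)` are the values at `0, 1, 2, 3`.  (The value for collinear
triples is a dummy.) -/
noncomputable def triadCircle (Q : Fin 4 → ℂ) (i : Fin 4) : EuclideanGeometry.Sphere ℂ :=
  if h : AffineIndependent ℝ (triad Q i) then
    (⟨triad Q i, h⟩ : Affine.Simplex ℝ ℂ 2).circumsphere
  else ⟨Q i, 0⟩

/-- The perpendicular bisector construction: the new vertices are the circumcenters of the triad
triangles. -/
noncomputable def nextQuadrilateral (Q : Fin 4 → ℂ) : Fin 4 → ℂ :=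
  fun i => (triadCircle Q i).center

/-- The generations of the iterative process, counted from `0`: `generation Q 0 = Q` is the first
generation `Q⁽¹⁾`, and `generation Q n` is `Q⁽ⁿ⁺¹⁾`. -/
noncomputable def generation (Q : Fin 4 → ℂ) (n : ℕ) : Fin 4 → ℂ :=
  nextQuadrilateral^[n] Q

/-- The circle of similitude of two circles, in the inversive plane `ℂ ∪ {∞}`: the points whose
distances to the centers are in the ratio of the radii.  The point `∞` belongs to it exactly when the
radii are equal, that is, when the locus is a line. -/
def circleOfSimilitude (s t : EuclideanGeometry.Sphere ℂ) : Set (OnePoint ℂ) :=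
  {P | (∃ z : ℂ, P = (z : OnePoint ℂ) ∧
          dist z s.center / dist z t.center = s.radius / t.radius) ∨
       (P = OnePoint.infty ∧ s.radius = t.radius)}

/-- `W` is the second point of intersection, other than the vertex `A`, of the circles of similitude
`CS(o₁, o₂)` and `CS(o₁, o₄)`. -/
def IsSecondIntersection (Q : Fin 4 → ℂ) (W : OnePoint ℂ) : Prop :=
  W ≠ (Q 0 : OnePoint ℂ) ∧
  W ∈ circleOfSimilitude (triadCircle Q 0) (triadCircle Q 1) ∧
  W ∈ circleOfSimilitude (triadCircle Q 0) (triadCircle Q 3)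

/-- The spiral similarity with center `w`, ratio `‖c‖` and rotation angle `arg c`. -/
def spiralSimilarity (w c : ℂ) : ℂ → ℂ :=
  fun z => w + c * (z - w)

/-- `W` is the center of a spiral similarity taking the circle `s` onto the circle `t`.  Spiral
similarities centered at `∞` are, by convention, the translations. -/
def IsSpiralCenter (W : OnePoint ℂ) (s t : EuclideanGeometry.Sphere ℂ) : Prop :=
  (∃ w c : ℂ, W = (w : OnePoint ℂ) ∧ c ≠ 0 ∧
      spiralSimilarity w c '' (s : Set ℂ) = (t : Set ℂ)) ∨
  (W = OnePoint.infty ∧ ∃ v : ℂ, (fun z => z + v) '' (s : Set ℂ) = (t : Set ℂ))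

/-! Write [xyz] for `signedArea`, D for `cyclicDet a b c d`, P for the product of the four triad
areas, and r = -D²/(4P) for `homothetyRatio`. Neighbouring triad circles share a side of the
quadrilateral, so the line joining their centers is perpendicular to that side, and the lengths of
these joins are rational in D and the areas. Two steps make two quarter turns: the sides of Q'' are
parallel to those of Q with the common real ratio r (`IsTriadCenters.sub_eq_ratio_mul`), hence Q'' =
rQ + v. One step multiplies areas by r (passing to the opposite triad triangle) and D by r², so r is
the same in every generation (`generationRatio_next`).

The decisive identity is `IsTriadCenters.isoptic_relation`, between a vertex a, its center o and the
vertex p of Q'' corresponding to a. If r ≠ 1, the homothety Q → Q'' has a finite center w, and the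
identity becomes |w - o|² = κR² with κ = r/(r - 1), for every triad circle of every generation.
Equal κ puts w on all circles of similitude and makes it a center of spiral similarities between any
two circles. The vertex A satisfies the analogous equations for its three circles with 1 in place of
κ; as κ ≠ 1, A and w are distinct, and `eq_or_eq_of_normSq_proportional` leaves no third common
point.

If r = 1, the identity reads |p - a|² = 0, so Q'' = Q. Then all radii agree, the circles of
similitude are perpendicular bisectors or the whole plane, with ∞ adjoined, and W = ∞. -/

/-! ### Signed areas, the concyclicity determinant and circumcenters in coordinates -/

/-- Twice the signed area of the triangle `abc`. -/
def signedArea (a b c : ℂ) : ℝ :=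
  (b.re - a.re) * (c.im - a.im) - (b.im - a.im) * (c.re - a.re)

/-- The determinant that vanishes exactly when four points of the plane lie on a circle or a line. -/
noncomputable def cyclicDet (a b c d : ℂ) : ℝ :=
  Complex.normSq (b - a) * signedArea a c d - Complex.normSq (c - a) * signedArea a b d
    + Complex.normSq (d - a) * signedArea a b c

/-- The point `o` has the same distance to `a`, `b` and `c`. -/
def IsEquidistant (o a b c : ℂ) : Prop :=
  Complex.normSq (o - a) = Complex.normSq (o - b) ∧ Complex.normSq (o - b) = Complex.normSq (o - c)

theorem IsEquidistant.rotate {o a b c : ℂ} (h : IsEquidistant o a b c) : IsEquidistant o b c a :=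
  ⟨h.2, (h.1.trans h.2).symm⟩

theorem signedArea_rotate (a b c : ℂ) : signedArea b c a = signedArea a b c := by
  simp only [signedArea]; ring

theorem cyclicDet_rotate (a b c d : ℂ) : cyclicDet b c d a = -cyclicDet a b c d := by
  simp only [cyclicDet, signedArea, Complex.normSq_apply, Complex.sub_re, Complex.sub_im]; ring

/-- Cramer's rule for the two perpendicular bisector equations, with the origin moved to `a`;
`IsEquidistant.im_eq` is the other coordinate. -/
theorem IsEquidistant.re_eq {o a b c : ℂ} (h : IsEquidistant o a b c) :
    2 * signedArea a b c * (o.re - a.re) =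
      Complex.normSq (b - a) * (c.im - a.im) - Complex.normSq (c - a) * (b.im - a.im) := by
  obtain ⟨h1, h2⟩ := h
  simp only [signedArea, Complex.normSq_apply, Complex.sub_re, Complex.sub_im] at *
  linear_combination (c.im - a.im) * h1 - (b.im - a.im) * (h1 + h2)

theorem IsEquidistant.im_eq {o a b c : ℂ} (h : IsEquidistant o a b c) :
    2 * signedArea a b c * (o.im - a.im) =
      Complex.normSq (c - a) * (b.re - a.re) - Complex.normSq (b - a) * (c.re - a.re) := by
  obtain ⟨h1, h2⟩ := h
  simp only [signedArea, Complex.normSq_apply, Complex.sub_re, Complex.sub_im] at *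
  linear_combination (b.re - a.re) * (h1 + h2) - (c.re - a.re) * h1

/-- The power of a fourth point with respect to a circumcircle. -/
theorem IsEquidistant.power {o a b c : ℂ} (h : IsEquidistant o a b c) (d : ℂ) :
    signedArea a b c * (Complex.normSq (o - d) - Complex.normSq (o - a)) = cyclicDet a b c d := by
  have h1 := h.re_eq
  have h2 := h.im_eq
  simp only [cyclicDet, signedArea, Complex.normSq_apply, Complex.sub_re, Complex.sub_im] at *
  linear_combination (a.re - d.re) * h1 + (a.im - d.im) * h2

/-- The common chord ab is perpendicular to the line of centers. Together with
`IsEquidistant.sub_im` this is o' - o = -i·D(b - a)/(2[dab][abc]). -/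
theorem IsEquidistant.sub_re {o o' a b c d : ℂ}
    (h : IsEquidistant o d a b) (h' : IsEquidistant o' a b c) :
    2 * signedArea d a b * signedArea a b c * (o'.re - o.re) =
      cyclicDet a b c d * (b.im - a.im) := by
  have h1 := h.rotate.re_eq
  have h2 := h'.re_eq
  simp only [cyclicDet, signedArea, Complex.normSq_apply, Complex.sub_re, Complex.sub_im] at *
  linear_combination ((a.re - d.re) * (b.im - d.im) - (a.im - d.im) * (b.re - d.re)) * h2
    - ((b.re - a.re) * (c.im - a.im) - (b.im - a.im) * (c.re - a.re)) * h1

theorem IsEquidistant.sub_im {o o' a b c d : ℂ}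
    (h : IsEquidistant o d a b) (h' : IsEquidistant o' a b c) :
    2 * signedArea d a b * signedArea a b c * (o'.im - o.im) =
      -cyclicDet a b c d * (b.re - a.re) := by
  have h1 := h.rotate.im_eq
  have h2 := h'.im_eq
  simp only [cyclicDet, signedArea, Complex.normSq_apply, Complex.sub_re, Complex.sub_im] at *
  linear_combination ((a.re - d.re) * (b.im - d.im) - (a.im - d.im) * (b.re - d.re)) * h2
    - ((b.re - a.re) * (c.im - a.im) - (b.im - a.im) * (c.re - a.re)) * h1

/-! ### One step of the construction: areas and determinant of the centers -/

/-- Circumcenters of the triad triangles of `abcd`. -/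
structure IsTriadCenters (a b c d o₁ o₂ o₃ o₄ : ℂ) : Prop where
  fst : IsEquidistant o₁ d a b
  snd : IsEquidistant o₂ a b c
  trd : IsEquidistant o₃ b c d
  fth : IsEquidistant o₄ c d a

theorem IsTriadCenters.rotate {a b c d o₁ o₂ o₃ o₄ : ℂ} (h : IsTriadCenters a b c d o₁ o₂ o₃ o₄) :
    IsTriadCenters b c d a o₂ o₃ o₄ o₁ :=
  ⟨h.snd, h.trd, h.fth, h.fst⟩

/-- No three of the four points are collinear and they do not lie on one circle. -/
structure IsNondegenerate (a b c d : ℂ) : Prop where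
  fst : signedArea d a b ≠ 0
  snd : signedArea a b c ≠ 0
  trd : signedArea b c d ≠ 0
  fth : signedArea c d a ≠ 0
  det : cyclicDet a b c d ≠ 0

theorem IsNondegenerate.rotate {a b c d : ℂ} (h : IsNondegenerate a b c d) :
    IsNondegenerate b c d a :=
  ⟨h.snd, h.trd, h.fth, h.fst, by rw [cyclicDet_rotate]; exact neg_ne_zero.2 h.det⟩

/-- The product of the signed areas of the four triad triangles. -/
def areaProd (a b c d : ℂ) : ℝ :=
  signedArea d a b * signedArea a b c * signedArea b c d * signedArea c d a

theorem areaProd_rotate (a b c d : ℂ) : areaProd b c d a = areaProd a b c d := by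
  simp only [areaProd]; ring

theorem IsNondegenerate.areaProd_ne_zero {a b c d : ℂ} (h : IsNondegenerate a b c d) :
    areaProd a b c d ≠ 0 :=
  mul_ne_zero (mul_ne_zero (mul_ne_zero h.fst h.snd) h.trd) h.fth

/-- The ratio of the homothety between a quadrilateral and the second generation after it. -/
noncomputable def homothetyRatio (a b c d : ℂ) : ℝ :=
  -(cyclicDet a b c d) ^ 2 / (4 * areaProd a b c d)

theorem homothetyRatio_rotate (a b c d : ℂ) : homothetyRatio b c d a = homothetyRatio a b c d := by
  unfold homothetyRatio
  rw [areaProd_rotate, cyclicDet_rotate, neg_sq]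

theorem IsNondegenerate.homothetyRatio_ne_zero {a b c d : ℂ} (h : IsNondegenerate a b c d) :
    homothetyRatio a b c d ≠ 0 :=
  div_ne_zero (neg_ne_zero.2 (pow_ne_zero 2 h.det)) (mul_ne_zero four_ne_zero h.areaProd_ne_zero)

/-- The sides o₁o₂ and o₂o₃ are ab and bc after a quarter turn, scaled by D/(2[dab][abc]) and
-D/(2[abc][bcd]). The area is therefore [abc] times the product of the scales, that is, r[cda]. -/
theorem IsTriadCenters.signedArea_snd {a b c d o₁ o₂ o₃ o₄ : ℂ}
    (h : IsTriadCenters a b c d o₁ o₂ o₃ o₄) (hn : IsNondegenerate a b c d) :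
    4 * areaProd a b c d * signedArea o₁ o₂ o₃ = -cyclicDet a b c d ^ 2 * signedArea c d a := by
  have hx := h.fst.sub_re h.snd
  have hy := h.fst.sub_im h.snd
  have hx' := h.snd.sub_re h.trd
  have hy' := h.snd.sub_im h.trd
  rw [cyclicDet_rotate a] at hx' hy'
  have e : signedArea o₁ o₂ o₃ =
      (o₂.re - o₁.re) * (o₃.im - o₂.im) - (o₂.im - o₁.im) * (o₃.re - o₂.re) := by
    simp only [signedArea]; ring
  have e' : signedArea a b c =
      (b.re - a.re) * (c.im - b.im) - (b.im - a.im) * (c.re - b.re) := by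
    simp only [signedArea]; ring
  have key : (signedArea a b c) * (4 * signedArea d a b * signedArea a b c * signedArea b c d *
      signedArea o₁ o₂ o₃) = signedArea a b c * (-cyclicDet a b c d ^ 2) := by
    have h3 : (2 * signedArea d a b * signedArea a b c * (o₂.re - o₁.re)) *
        (2 * signedArea a b c * signedArea b c d * (o₃.im - o₂.im)) -
        (2 * signedArea d a b * signedArea a b c * (o₂.im - o₁.im)) *
        (2 * signedArea a b c * signedArea b c d * (o₃.re - o₂.re)) =
        -cyclicDet a b c d ^ 2 * signedArea a b c := by
      rw [hx, hy, hx', hy']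
      linear_combination cyclicDet a b c d ^ 2 * e'
    rw [e]; linear_combination h3
  have := mul_left_cancel₀ hn.snd key
  simp only [areaProd]
  linear_combination signedArea c d a * this

theorem IsTriadCenters.signedArea_fst {a b c d o₁ o₂ o₃ o₄ : ℂ}
    (h : IsTriadCenters a b c d o₁ o₂ o₃ o₄) (hn : IsNondegenerate a b c d) :
    4 * areaProd a b c d * signedArea o₄ o₁ o₂ = -cyclicDet a b c d ^ 2 * signedArea b c d := by
  have t1 := h.rotate.rotate.rotate.signedArea_snd hn.rotate.rotate.rotate
  simpa only [areaProd_rotate a b c d, areaProd_rotate b c d a, areaProd_rotate c d a b,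
    cyclicDet_rotate a b c d, cyclicDet_rotate b c d a, cyclicDet_rotate c d a b,
    neg_neg, neg_sq] using t1

/-- The power of c with respect to the circle dab, computed from the areal coordinates (-[bcd] :
[cda] : [abc]) of c relative to a, b, d. -/
theorem power_areal (a b c d : ℂ) :
    -(signedArea d a b * cyclicDet a b c d) =
      Complex.normSq (b - a) * (signedArea b c d * signedArea c d a)
      - Complex.normSq (d - b) * (signedArea a b c * signedArea c d a)
      + Complex.normSq (d - a) * (signedArea a b c * signedArea b c d) := by
  simp only [cyclicDet, signedArea, Complex.normSq_apply, Complex.sub_re, Complex.sub_im]; ring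

theorem IsEquidistant.normSq_sub {o o' a b c d : ℂ}
    (h : IsEquidistant o d a b) (h' : IsEquidistant o' a b c) :
    4 * signedArea d a b ^ 2 * signedArea a b c ^ 2 * Complex.normSq (o' - o) =
      cyclicDet a b c d ^ 2 * Complex.normSq (b - a) := by
  have h1 := h.sub_re h'
  have h2 := h.sub_im h'
  simp only [Complex.normSq_apply, Complex.sub_re, Complex.sub_im]
  linear_combination (2 * signedArea d a b * signedArea a b c * (o'.re - o.re) +
      cyclicDet a b c d * (b.im - a.im)) * h1 +
    (2 * signedArea d a b * signedArea a b c * (o'.im - o.im) -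
      cyclicDet a b c d * (b.re - a.re)) * h2

/-- Equivalently, the determinant is multiplied by r². Expanding it at o₁ needs three areas and
three squared distances, all known; the resulting sum is the one in `power_areal`. -/
theorem IsTriadCenters.cyclicDet_centers {a b c d o₁ o₂ o₃ o₄ : ℂ}
    (h : IsTriadCenters a b c d o₁ o₂ o₃ o₄) (hn : IsNondegenerate a b c d) :
    16 * areaProd a b c d ^ 2 * cyclicDet o₁ o₂ o₃ o₄ = cyclicDet a b c d ^ 5 := by
  have t2 := h.signedArea_snd hn
  have t4 := h.rotate.rotate.signedArea_snd hn.rotate.rotate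
  have t1 := h.signedArea_fst hn
  simp only [areaProd_rotate a b c d, areaProd_rotate b c d a, cyclicDet_rotate a b c d,
    cyclicDet_rotate b c d a, neg_neg] at t4
  rw [← signedArea_rotate o₄ o₁ o₂] at t1
  rw [signedArea_rotate o₁ o₃ o₄] at t4
  have n2 := h.fst.normSq_sub h.snd
  have n4 := h.fth.normSq_sub h.fst
  -- The opposite circles o₁ and o₃ share the diagonal bd, so the chord formula applies to them
  -- after relabelling.
  have n3 := h.fst.rotate.normSq_sub (o' := o₃) (c := c) ⟨h.trd.1.trans h.trd.2, h.trd.2.symm⟩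
  have e1 : signedArea a b d = signedArea d a b := by simp only [signedArea]; ring
  have e3 : signedArea b d c = -signedArea b c d := by simp only [signedArea]; ring
  have e5 : cyclicDet b d c a = cyclicDet a b c d := by
    simp only [cyclicDet, signedArea, Complex.normSq_apply, Complex.sub_re, Complex.sub_im]
    ring
  have e6 : cyclicDet d a b c = - cyclicDet a b c d := by
    rw [cyclicDet_rotate d a b c, neg_neg]
  rw [e1, e3, e5, neg_sq] at n3
  rw [e6, neg_sq, ← Complex.normSq_neg, neg_sub, ← Complex.normSq_neg (a - d), neg_sub] at n4
  have hp := power_areal a b c d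
  refine mul_left_cancel₀ hn.fst ?_
  generalize cyclicDet a b c d = D at *
  simp only [areaProd, cyclicDet] at *
  generalize signedArea d a b = s₁, signedArea a b c = s₂, signedArea b c d = s₃,
    signedArea c d a = s₄ at *
  linear_combination (4 * (s₁ * s₂ * s₃ * s₄) * s₁) * (Complex.normSq (o₂ - o₁) * t4 -
    Complex.normSq (o₃ - o₁) * t1 + Complex.normSq (o₄ - o₁) * t2) -
    D ^ 2 * (s₃ * s₄ * n2 - s₂ * s₄ * n3 + s₂ * s₃ * n4) + D ^ 4 * hp

/-! ### Two steps of the construction: parallel sides and the isoptic relation -/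

/-- Corresponding sides of a quadrilateral and of the second generation after it are parallel, with a
ratio that does not depend on the side. -/
theorem IsTriadCenters.sub_eq_ratio_mul {a b c d o₁ o₂ o₃ o₄ p₁ p₂ p₃ p₄ : ℂ}
    (h : IsTriadCenters a b c d o₁ o₂ o₃ o₄) (h' : IsTriadCenters o₁ o₂ o₃ o₄ p₁ p₂ p₃ p₄)
    (hn : IsNondegenerate a b c d) :
    p₂ - p₁ = (homothetyRatio a b c d : ℂ) * (b - a) := by
  have t2 := h.signedArea_snd hn
  have t1 := h.signedArea_fst hn
  have hD := h.cyclicDet_centers hn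
  have x1 := h.fst.sub_re h.snd
  have y1 := h.fst.sub_im h.snd
  have x2 := h'.fst.sub_re h'.snd
  have y2 := h'.fst.sub_im h'.snd
  have hP := hn.areaProd_ne_zero
  obtain ⟨h1, h2, h3, h4, h5⟩ := hn
  have t1e : signedArea o₄ o₁ o₂ = -cyclicDet a b c d ^ 2 * signedArea b c d /
      (4 * areaProd a b c d) := by field_simp; linear_combination t1
  have t2e : signedArea o₁ o₂ o₃ = -cyclicDet a b c d ^ 2 * signedArea c d a /
      (4 * areaProd a b c d) := by field_simp; linear_combination t2
  have hDe : cyclicDet o₁ o₂ o₃ o₄ = cyclicDet a b c d ^ 5 /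
      (16 * areaProd a b c d ^ 2) := by field_simp; linear_combination hD
  rw [t1e, t2e, hDe] at x2 y2
  have ex : o₂.re - o₁.re = cyclicDet a b c d * (b.im - a.im) /
      (2 * signedArea d a b * signedArea a b c) := by field_simp; linear_combination x1
  have ey : o₂.im - o₁.im = -cyclicDet a b c d * (b.re - a.re) /
      (2 * signedArea d a b * signedArea a b c) := by field_simp; linear_combination y1
  -- Substituting one perpendicularity into the other composes two quarter turns, so the resulting
  -- factor is real.
  rw [ey] at x2
  rw [ex] at y2
  simp only [homothetyRatio, areaProd] at *
  generalize cyclicDet a b c d = D at *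
  generalize signedArea d a b = s₁, signedArea a b c = s₂, signedArea b c d = s₃,
    signedArea c d a = s₄ at *
  have hK : 2 * (-D ^ 2 * s₃ / (4 * (s₁ * s₂ * s₃ * s₄))) *
      (-D ^ 2 * s₄ / (4 * (s₁ * s₂ * s₃ * s₄))) ≠ 0 := by simp [h1, h2, h3, h4, h5]
  apply Complex.ext
  · refine mul_left_cancel₀ hK ?_
    rw [Complex.re_ofReal_mul, Complex.sub_re, Complex.sub_re, x2]
    field_simp
    ring
  · refine mul_left_cancel₀ hK ?_
    rw [Complex.im_ofReal_mul, Complex.sub_im, Complex.sub_im, y2]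
    field_simp
    ring

/-- The identity to which the isoptic relation reduces. It follows from [dab](c - a) = [cda](b - a)
+ [abc](d - a), which eliminates c, and from [bcd] = [abc] + [cda] - [dab]. -/
theorem signedArea_relation (a b c d : ℂ) :
    signedArea b c d * (signedArea c d a ^ 2 * Complex.normSq (b - a) +
      signedArea a b c ^ 2 * Complex.normSq (d - a) + 2 * signedArea a b c * signedArea c d a *
        ((b.re - a.re) * (d.re - a.re) + (b.im - a.im) * (d.im - a.im))) -
      signedArea d a b * signedArea a b c * signedArea c d a * Complex.normSq (d - b) =
    -(cyclicDet a b c d * signedArea d a b * (signedArea a b c + signedArea c d a)) := by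
  have h3 : signedArea b c d = signedArea a b c + signedArea c d a - signedArea d a b := by
    simp only [signedArea]; ring
  have hD : cyclicDet a b c d = Complex.normSq (b - a) * signedArea c d a -
      Complex.normSq (c - a) * signedArea d a b + Complex.normSq (d - a) * signedArea a b c := by
    simp only [cyclicDet, signedArea]; ring
  have hx : signedArea d a b * (c.re - a.re) =
      signedArea c d a * (b.re - a.re) + signedArea a b c * (d.re - a.re) := by
    simp only [signedArea]; ring
  have hy : signedArea d a b * (c.im - a.im) =
      signedArea c d a * (b.im - a.im) + signedArea a b c * (d.im - a.im) := by
    simp only [signedArea]; ring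
  rw [hD, h3]
  generalize signedArea d a b = s₁, signedArea a b c = s₂, signedArea c d a = s₄ at *
  simp only [Complex.normSq_apply, Complex.sub_re, Complex.sub_im]
  linear_combination -(s₂ + s₄) * (s₁ * (c.re - a.re) + (s₄ * (b.re - a.re) + s₂ * (d.re - a.re))) * hx +
    -(s₂ + s₄) * (s₁ * (c.im - a.im) + (s₄ * (b.im - a.im) + s₂ * (d.im - a.im))) * hy

/-- Cramer's formula for the circumcenter of o₄o₁o₂, with the sides at o₁ expressed through ab and
ad. The area [bcd] occurs on both sides and cancels. -/
theorem IsTriadCenters.sub_fst {a b c d o₁ o₂ o₃ o₄ p : ℂ}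
    (h : IsTriadCenters a b c d o₁ o₂ o₃ o₄) (hp : IsEquidistant p o₄ o₁ o₂)
    (hn : IsNondegenerate a b c d) :
    4 * signedArea d a b ^ 2 * signedArea a b c * signedArea c d a * (p.re - o₁.re) =
      -cyclicDet a b c d * (signedArea c d a * Complex.normSq (b - a) * (d.re - a.re) +
        signedArea a b c * Complex.normSq (d - a) * (b.re - a.re)) ∧
    4 * signedArea d a b ^ 2 * signedArea a b c * signedArea c d a * (p.im - o₁.im) =
      -cyclicDet a b c d * (signedArea c d a * Complex.normSq (b - a) * (d.im - a.im) +
        signedArea a b c * Complex.normSq (d - a) * (b.im - a.im)) := by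
  have t1 := h.signedArea_fst hn
  have n2 := h.fst.normSq_sub h.snd
  have n4 := h.fth.normSq_sub h.fst
  have x1 := h.fst.sub_re h.snd
  have y1 := h.fst.sub_im h.snd
  have x4 := h.fth.sub_re h.fst
  have y4 := h.fth.sub_im h.fst
  have e6 : cyclicDet d a b c = - cyclicDet a b c d := by
    rw [cyclicDet_rotate d a b c, neg_neg]
  rw [e6] at x4 y4
  rw [e6, neg_sq, ← Complex.normSq_neg, neg_sub, ← Complex.normSq_neg (a - d), neg_sub] at n4
  have u1 := hp.rotate.re_eq
  have u2 := hp.rotate.im_eq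
  rw [signedArea_rotate o₄ o₁ o₂] at u1 u2
  obtain ⟨h1, h2, h3, h4, h5⟩ := hn
  generalize cyclicDet a b c d = D at *
  simp only [areaProd] at *
  generalize signedArea d a b = s₁, signedArea a b c = s₂, signedArea b c d = s₃,
    signedArea c d a = s₄, signedArea o₄ o₁ o₂ = t at *
  generalize Complex.normSq (o₂ - o₁) = N2, Complex.normSq (o₄ - o₁) = N4,
    Complex.normSq (b - a) = n, Complex.normSq (d - a) = m at *
  have ht : t = -D ^ 2 * s₃ / (4 * (s₁ * s₂ * s₃ * s₄)) := by 
    refine eq_div_of_mul_eq (by positivity) ?_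
    linear_combination t1
  have hN2 : N2 = D ^ 2 * n / (4 * s₁ ^ 2 * s₂ ^ 2) := by field_simp; linear_combination n2
  have hN4 : N4 = D ^ 2 * m / (4 * s₄ ^ 2 * s₁ ^ 2) := by field_simp; linear_combination n4
  have ex1 : o₂.re - o₁.re = D * (b.im - a.im) / (2 * s₁ * s₂) := by
    field_simp; linear_combination x1
  have ey1 : o₂.im - o₁.im = -D * (b.re - a.re) / (2 * s₁ * s₂) := by
    field_simp; linear_combination y1
  have ex4 : o₄.re - o₁.re = -D * (d.im - a.im) / (2 * s₄ * s₁) := by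
    field_simp; linear_combination -x4
  have ey4 : o₄.im - o₁.im = D * (d.re - a.re) / (2 * s₄ * s₁) := by
    field_simp; linear_combination -y4
  rw [ht, hN2, hN4, ey1, ey4] at u1
  rw [ht, hN2, hN4, ex1, ex4] at u2
  have hK : 2 * (-D ^ 2 * s₃ / (4 * (s₁ * s₂ * s₃ * s₄))) ≠ 0 := by simp [h1, h2, h3, h4, h5]
  constructor
  · refine mul_left_cancel₀ hK ?_
    rw [mul_left_comm, u1]
    field_simp
    ring
  · refine mul_left_cancel₀ hK ?_
    rw [mul_left_comm, u2]
    field_simp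
    ring

/-- The relation between the first vertex, the first center and the corresponding center of the next
generation that determines the isoptic point. -/
theorem IsTriadCenters.isoptic_relation {a b c d o₁ o₂ o₃ o₄ p : ℂ}
    (h : IsTriadCenters a b c d o₁ o₂ o₃ o₄) (hp : IsEquidistant p o₄ o₁ o₂)
    (hn : IsNondegenerate a b c d) :
    Complex.normSq (p - o₁) + homothetyRatio a b c d * Complex.normSq (a - o₁) =
      2 * homothetyRatio a b c d *
        ((p.re - o₁.re) * (a.re - o₁.re) + (p.im - o₁.im) * (a.im - o₁.im)) := by
  obtain ⟨u1, u2⟩ := h.sub_fst hp hn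
  have v1 := h.fst.rotate.re_eq
  have v2 := h.fst.rotate.im_eq
  have hs := signedArea_relation a b c d
  rw [signedArea_rotate d a b] at v1 v2
  have e1 : signedArea d a b =
      (b.re - a.re) * (d.im - a.im) - (b.im - a.im) * (d.re - a.re) := by
    simp only [signedArea]; ring
  obtain ⟨h1, h2, h3, h4, h5⟩ := hn
  unfold homothetyRatio areaProd
  generalize cyclicDet a b c d = D at *
  simp only [Complex.normSq_apply, Complex.sub_re, Complex.sub_im] at *
  have e2 : d.re - b.re = (d.re - a.re) - (b.re - a.re) := by ring
  have e3 : d.im - b.im = (d.im - a.im) - (b.im - a.im) := by ring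
  rw [e2, e3] at hs
  rw [← neg_sub o₁.re a.re, ← neg_sub o₁.im a.im]
  generalize signedArea d a b = s₁, signedArea a b c = s₂, signedArea b c d = s₃,
    signedArea c d a = s₄, p.re - o₁.re = ux, p.im - o₁.im = uy, o₁.re - a.re = vx,
    o₁.im - a.im = vy, b.re - a.re = bx, b.im - a.im = bY, d.re - a.re = dx,
    d.im - a.im = dy at *
  obtain rfl : ux = _ := eq_div_of_mul_eq (by positivity) ((mul_comm _ _).trans u1)
  obtain rfl : uy = _ := eq_div_of_mul_eq (by positivity) ((mul_comm _ _).trans u2)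
  obtain rfl : vx = _ := eq_div_of_mul_eq (by positivity) ((mul_comm _ _).trans v1)
  obtain rfl : vy = _ := eq_div_of_mul_eq (by positivity) ((mul_comm _ _).trans v2)
  field_simp
  -- After clearing denominators the relation is |ab|²|ad|² times `signedArea_relation`, up to
  -- rewriting [dab] in coordinates.
  linear_combination 4 * (bx ^ 2 + bY ^ 2) * (dx ^ 2 + dy ^ 2) * hs -
    4 * D * (bx ^ 2 + bY ^ 2) * (dx ^ 2 + dy ^ 2) * (s₂ + s₄) * e1

/-! ### From triad circles to coordinates -/

theorem IsEquidistant.unique {o o' a b c : ℂ} (h : IsEquidistant o a b c)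
    (h' : IsEquidistant o' a b c) (hs : signedArea a b c ≠ 0) : o = o' := by
  have hs2 : 2 * signedArea a b c ≠ 0 := mul_ne_zero two_ne_zero hs
  apply Complex.ext
  · linarith [mul_left_cancel₀ hs2 (h.re_eq.trans h'.re_eq.symm)]
  · linarith [mul_left_cancel₀ hs2 (h.im_eq.trans h'.im_eq.symm)]

theorem affineIndependent_iff_signedArea_ne_zero (a b c : ℂ) :
    AffineIndependent ℝ ![a, b, c] ↔ signedArea a b c ≠ 0 := by
  rw [← not_iff_not, not_ne_iff, ← collinear_iff_not_affineIndependent_set,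
    collinear_iff_of_mem (Set.mem_insert a _)]
  constructor
  · rintro ⟨v, hv⟩
    obtain ⟨r, hr⟩ := hv b (by simp)
    obtain ⟨t, ht⟩ := hv c (by simp)
    rw [hr, ht]
    simp [signedArea]
    ring
  · intro h
    by_cases hb : b = a
    · refine ⟨c - a, ?_⟩
      rintro p (rfl | rfl | rfl)
      · exact ⟨0, by simp⟩
      · exact ⟨0, by simp [hb]⟩
      · exact ⟨1, by simp⟩
    · refine ⟨b - a, ?_⟩
      have hn : Complex.normSq (b - a) ≠ 0 := by simpa [sub_eq_zero] using hb
      rintro p (rfl | rfl | rfl)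
      · exact ⟨0, by simp⟩
      · exact ⟨1, by simp⟩
      · refine ⟨((b.re - a.re) * (p.re - a.re) + (b.im - a.im) * (p.im - a.im)) /
          Complex.normSq (b - a), ?_⟩
        simp only [signedArea] at h
        apply Complex.ext
        · simp only [vadd_eq_add, Complex.add_re, Complex.real_smul, Complex.re_ofReal_mul]
          field_simp
          simp only [Complex.normSq_apply, Complex.sub_re, Complex.sub_im]
          linear_combination -(b.im - a.im) * h
        · simp only [vadd_eq_add, Complex.add_im, Complex.real_smul, Complex.im_ofReal_mul]
          field_simp
          simp only [Complex.normSq_apply, Complex.sub_re, Complex.sub_im]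
          linear_combination (b.re - a.re) * h

theorem dist_sq_eq_normSq (z w : ℂ) : dist z w ^ 2 = Complex.normSq (z - w) := by
  rw [dist_eq_norm, Complex.normSq_eq_norm_sq]

theorem dist_eq_dist_iff_normSq {z w z' w' : ℂ} :
    dist z w = dist z' w' ↔ Complex.normSq (z - w) = Complex.normSq (z' - w') := by
  rw [← dist_sq_eq_normSq, ← dist_sq_eq_normSq, sq_eq_sq₀ dist_nonneg dist_nonneg]

theorem triadCircle_dist {Q : Fin 4 → ℂ} (hQ : IsNoncyclicQuadrilateral Q) (i : Fin 4) (j : Fin 3) :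
    dist (nextQuadrilateral Q i) (triad Q i j) = (triadCircle Q i).radius := by
  rw [nextQuadrilateral, triadCircle, dif_pos (hQ.1 i), dist_comm]
  exact (⟨triad Q i, hQ.1 i⟩ : Affine.Simplex ℝ ℂ 2).mem_circumsphere j

theorem triadCircle_radius_pos {Q : Fin 4 → ℂ} (hQ : IsNoncyclicQuadrilateral Q) (i : Fin 4) :
    0 < (triadCircle Q i).radius := by
  rw [triadCircle, dif_pos (hQ.1 i)]
  exact (⟨triad Q i, hQ.1 i⟩ : Affine.Simplex ℝ ℂ 2).circumradius_pos

theorem isEquidistant_iff_dist {o a b c : ℂ} :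
    IsEquidistant o a b c ↔ dist o a = dist o b ∧ dist o b = dist o c := by
  rw [dist_eq_dist_iff_normSq, dist_eq_dist_iff_normSq, IsEquidistant]

theorem isEquidistant_nextQuadrilateral {Q : Fin 4 → ℂ} (hQ : IsNoncyclicQuadrilateral Q)
    (i : Fin 4) : IsEquidistant (nextQuadrilateral Q i) (Q (i - 1)) (Q i) (Q (i + 1)) := by
  have h := triadCircle_dist hQ i
  exact isEquidistant_iff_dist.2 ⟨(h 0).trans (h 1).symm, (h 1).trans (h 2).symm⟩

/-- By `IsEquidistant.power`, the determinant is a nonzero area times the power of the fourth vertex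
with respect to the circle through the other three. -/
theorem isNoncyclicQuadrilateral_iff (Q : Fin 4 → ℂ) :
    IsNoncyclicQuadrilateral Q ↔ IsNondegenerate (Q 0) (Q 1) (Q 2) (Q 3) := by
  have hA : (∀ i, AffineIndependent ℝ (triad Q i)) ↔
      signedArea (Q 3) (Q 0) (Q 1) ≠ 0 ∧ signedArea (Q 0) (Q 1) (Q 2) ≠ 0 ∧
      signedArea (Q 1) (Q 2) (Q 3) ≠ 0 ∧ signedArea (Q 2) (Q 3) (Q 0) ≠ 0 := by
    simp only [triad, affineIndependent_iff_signedArea_ne_zero]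
    refine ⟨fun h => ⟨h 0, h 1, h 2, h 3⟩, ?_⟩
    rintro ⟨h0, h1, h2, h3⟩ i
    fin_cases i
    exacts [h0, h1, h2, h3]
  constructor
  · intro hQ
    obtain ⟨h0, h1, h2, h3⟩ := hA.1 hQ.1
    refine ⟨h0, h1, h2, h3, fun hD => hQ.2 ⟨nextQuadrilateral Q 1, (triadCircle Q 1).radius, ?_⟩⟩
    have he := isEquidistant_nextQuadrilateral hQ 1
    have hp := he.power (Q 3)
    have hd := triadCircle_dist hQ 1
    have hp' : Complex.normSq (nextQuadrilateral Q 1 - Q 3) =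
        Complex.normSq (nextQuadrilateral Q 1 - Q 0) := by
      have := (mul_eq_zero.1 (hp.trans hD)).resolve_left h1
      exact sub_eq_zero.1 this
    rintro _ ⟨i, rfl⟩
    rw [dist_comm]
    fin_cases i
    · exact hd 0
    · exact hd 1
    · exact hd 2
    · exact (dist_eq_dist_iff_normSq.2 hp').trans (hd 0)
  · intro h
    refine ⟨hA.2 ⟨h.fst, h.snd, h.trd, h.fth⟩, ?_⟩
    rintro ⟨o, r, hr⟩
    have hd : ∀ i j, Complex.normSq (o - Q i) = Complex.normSq (o - Q j) := fun i j => by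
      rw [← dist_eq_dist_iff_normSq, dist_comm, hr _ ⟨i, rfl⟩, dist_comm, hr _ ⟨j, rfl⟩]
    have he : IsEquidistant o (Q 0) (Q 1) (Q 2) := ⟨hd _ _, hd _ _⟩
    exact h.det (by rw [← he.power (Q 3), hd 3 0, sub_self, mul_zero])

theorem isTriadCenters_nextQuadrilateral {Q : Fin 4 → ℂ} (hQ : IsNoncyclicQuadrilateral Q) :
    IsTriadCenters (Q 0) (Q 1) (Q 2) (Q 3) (nextQuadrilateral Q 0) (nextQuadrilateral Q 1)
      (nextQuadrilateral Q 2) (nextQuadrilateral Q 3) :=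
  ⟨isEquidistant_nextQuadrilateral hQ 0, isEquidistant_nextQuadrilateral hQ 1,
    isEquidistant_nextQuadrilateral hQ 2, isEquidistant_nextQuadrilateral hQ 3⟩

/-! ### Persistence of nondegeneracy and invariance of the ratio -/

theorem IsTriadCenters.signedArea_fst_ne_zero {a b c d o₁ o₂ o₃ o₄ : ℂ}
    (h : IsTriadCenters a b c d o₁ o₂ o₃ o₄) (hn : IsNondegenerate a b c d) :
    signedArea o₄ o₁ o₂ ≠ 0 := fun h0 => by
  have := h.signedArea_fst hn
  rw [h0, mul_zero, eq_comm, mul_eq_zero] at this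
  exact this.elim (neg_ne_zero.2 (pow_ne_zero 2 hn.det)) hn.trd

theorem IsTriadCenters.isNondegenerate {a b c d o₁ o₂ o₃ o₄ : ℂ}
    (h : IsTriadCenters a b c d o₁ o₂ o₃ o₄) (hn : IsNondegenerate a b c d) :
    IsNondegenerate o₁ o₂ o₃ o₄ where
  fst := h.signedArea_fst_ne_zero hn
  snd := h.rotate.signedArea_fst_ne_zero hn.rotate
  trd := h.rotate.rotate.signedArea_fst_ne_zero hn.rotate.rotate
  fth := h.rotate.rotate.rotate.signedArea_fst_ne_zero hn.rotate.rotate.rotate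
  det h0 := by
    have := h.cyclicDet_centers hn
    rw [h0, mul_zero] at this
    exact pow_ne_zero 5 hn.det this.symm

theorem IsNoncyclicQuadrilateral.next {Q : Fin 4 → ℂ} (hQ : IsNoncyclicQuadrilateral Q) :
    IsNoncyclicQuadrilateral (nextQuadrilateral Q) :=
  (isNoncyclicQuadrilateral_iff _).2 ((isTriadCenters_nextQuadrilateral hQ).isNondegenerate
    ((isNoncyclicQuadrilateral_iff _).1 hQ))

/-- The ratio of the homothety taking a quadrilateral to the second generation after it. -/
noncomputable def generationRatio (Q : Fin 4 → ℂ) : ℝ :=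
  homothetyRatio (Q 0) (Q 1) (Q 2) (Q 3)

theorem IsNoncyclicQuadrilateral.generationRatio_ne_zero {Q : Fin 4 → ℂ}
    (hQ : IsNoncyclicQuadrilateral Q) : generationRatio Q ≠ 0 :=
  ((isNoncyclicQuadrilateral_iff Q).1 hQ).homothetyRatio_ne_zero

theorem forall_fin_four_rotate {p : ℂ → ℂ → ℂ → ℂ → Prop}
    (hp : ∀ a b c d, p a b c d → p b c d a) {Q : Fin 4 → ℂ} (h : p (Q 0) (Q 1) (Q 2) (Q 3))
    (i : Fin 4) : p (Q i) (Q (i + 1)) (Q (i + 2)) (Q (i + 3)) := by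
  fin_cases i
  · exact h
  · exact hp _ _ _ _ h
  · exact hp _ _ _ _ (hp _ _ _ _ h)
  · exact hp _ _ _ _ (hp _ _ _ _ (hp _ _ _ _ h))

theorem isNondegenerate_rotate {Q : Fin 4 → ℂ} (hQ : IsNoncyclicQuadrilateral Q) (i : Fin 4) :
    IsNondegenerate (Q i) (Q (i + 1)) (Q (i + 2)) (Q (i + 3)) :=
  forall_fin_four_rotate (fun _ _ _ _ h => h.rotate) ((isNoncyclicQuadrilateral_iff _).1 hQ) i

theorem homothetyRatio_eq_generationRatio (Q : Fin 4 → ℂ) (i : Fin 4) :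
    homothetyRatio (Q i) (Q (i + 1)) (Q (i + 2)) (Q (i + 3)) = generationRatio Q :=
  forall_fin_four_rotate (p := fun a b c d => homothetyRatio a b c d = generationRatio Q)
    (fun _ _ _ _ h => (homothetyRatio_rotate _ _ _ _).trans h) rfl i

theorem isTriadCenters_rotate {Q : Fin 4 → ℂ} (hQ : IsNoncyclicQuadrilateral Q) (i : Fin 4) :
    IsTriadCenters (Q i) (Q (i + 1)) (Q (i + 2)) (Q (i + 3)) (nextQuadrilateral Q i)
      (nextQuadrilateral Q (i + 1)) (nextQuadrilateral Q (i + 2)) (nextQuadrilateral Q (i + 3)) := by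
  have h := isTriadCenters_nextQuadrilateral hQ
  fin_cases i
  · exact h
  · exact h.rotate
  · exact h.rotate.rotate
  · exact h.rotate.rotate.rotate

/-- Each triad area of the centers is r times the opposite triad area, so P becomes r⁴P; D becomes
r²D, and D²/P is unchanged. -/
theorem generationRatio_next {Q : Fin 4 → ℂ} (hQ : IsNoncyclicQuadrilateral Q) :
    generationRatio (nextQuadrilateral Q) = generationRatio Q := by
  have h := isTriadCenters_nextQuadrilateral hQ
  have hn := (isNoncyclicQuadrilateral_iff _).1 hQ
  have hD := h.cyclicDet_centers hn
  have s1 := h.signedArea_fst hn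
  have s2 := h.signedArea_snd hn
  have s3 := h.rotate.signedArea_snd hn.rotate
  have s4 := h.rotate.rotate.signedArea_snd hn.rotate.rotate
  have hP := hn.areaProd_ne_zero
  have hP' := (h.isNondegenerate hn).areaProd_ne_zero
  have hd := hn.det
  unfold generationRatio homothetyRatio
  generalize Q 0 = a, Q 1 = b, Q 2 = c, Q 3 = d, nextQuadrilateral Q 0 = o₁,
    nextQuadrilateral Q 1 = o₂, nextQuadrilateral Q 2 = o₃, nextQuadrilateral Q 3 = o₄ at *
  simp only [areaProd_rotate a b c d, areaProd_rotate b c d a, cyclicDet_rotate a b c d,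
    cyclicDet_rotate b c d a, neg_neg, neg_sq] at s3 s4
  have hPP : 256 * areaProd a b c d ^ 4 * areaProd o₁ o₂ o₃ o₄ =
      cyclicDet a b c d ^ 8 * areaProd a b c d := by
    calc _ = (4 * areaProd a b c d * signedArea o₄ o₁ o₂) *
          (4 * areaProd a b c d * signedArea o₁ o₂ o₃) *
          (4 * areaProd a b c d * signedArea o₂ o₃ o₄) *
          (4 * areaProd a b c d * signedArea o₃ o₄ o₁) := by
          rw [areaProd.eq_def o₁]; ring
      _ = _ := by
          rw [s1, s2, s3, s4]
          unfold areaProd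
          ring
  generalize cyclicDet a b c d = D, cyclicDet o₁ o₂ o₃ o₄ = D' at *
  generalize areaProd a b c d = P, areaProd o₁ o₂ o₃ o₄ = P' at *
  rw [div_eq_div_iff (by positivity) (by positivity)]
  refine mul_left_cancel₀ (a := 256 * P ^ 4) (by positivity) ?_
  linear_combination (-4 * P * (16 * P ^ 2 * D' + D ^ 5)) * hD + 4 * D ^ 2 * hPP

/-- Sides of the second next generation are parallel to those of the given one. -/
theorem next_next_sub {Q : Fin 4 → ℂ} (hQ : IsNoncyclicQuadrilateral Q) (i : Fin 4) :
    nextQuadrilateral (nextQuadrilateral Q) (i + 1) - nextQuadrilateral (nextQuadrilateral Q) i =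
      (generationRatio Q : ℂ) * (Q (i + 1) - Q i) := by
  rw [← homothetyRatio_eq_generationRatio Q i]
  exact (isTriadCenters_rotate hQ i).sub_eq_ratio_mul (isTriadCenters_rotate hQ.next i)
    (isNondegenerate_rotate hQ i)

theorem next_next_isoptic_relation {Q : Fin 4 → ℂ} (hQ : IsNoncyclicQuadrilateral Q) (i : Fin 4) :
    Complex.normSq (nextQuadrilateral (nextQuadrilateral Q) i - nextQuadrilateral Q i) +
      generationRatio Q * Complex.normSq (Q i - nextQuadrilateral Q i) =
    2 * generationRatio Q *
      (((nextQuadrilateral (nextQuadrilateral Q) i).re - (nextQuadrilateral Q i).re) *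
        ((Q i).re - (nextQuadrilateral Q i).re) +
      ((nextQuadrilateral (nextQuadrilateral Q) i).im - (nextQuadrilateral Q i).im) *
        ((Q i).im - (nextQuadrilateral Q i).im)) := by
  rw [← homothetyRatio_eq_generationRatio Q i]
  exact (isTriadCenters_rotate hQ i).isoptic_relation (isTriadCenters_rotate hQ.next i).fst
    (isNondegenerate_rotate hQ i)

theorem exists_next_next_eq {Q : Fin 4 → ℂ} (hQ : IsNoncyclicQuadrilateral Q) :
    ∃ v : ℂ, ∀ i, nextQuadrilateral (nextQuadrilateral Q) i = (generationRatio Q : ℂ) * Q i + v := by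
  refine ⟨nextQuadrilateral (nextQuadrilateral Q) 0 - (generationRatio Q : ℂ) * Q 0, ?_⟩
  have h0 := next_next_sub hQ 0
  have h1 := next_next_sub hQ 1
  have h2 := next_next_sub hQ 2
  simp only [zero_add, show (1 : Fin 4) + 1 = 2 from rfl, show (2 : Fin 4) + 1 = 3 from rfl]
    at h0 h1 h2
  intro i
  fin_cases i
  · simp
  · simp only [Fin.mk_one]; linear_combination h0
  · simp only [Fin.reduceFinMk]; linear_combination h0 + h1
  · simp only [Fin.reduceFinMk]; linear_combination h0 + h1 + h2

/-! ### Radii, spiral similarities and generations -/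

theorem normSq_sub_eq_radius_sq {Q : Fin 4 → ℂ} (hQ : IsNoncyclicQuadrilateral Q) (i : Fin 4) :
    Complex.normSq (Q i - nextQuadrilateral Q i) = (triadCircle Q i).radius ^ 2 := by
  rw [← dist_sq_eq_normSq, dist_comm]
  exact congrArg (· ^ 2) (triadCircle_dist hQ i 1)

theorem normSq_pred_sub_eq_radius_sq {Q : Fin 4 → ℂ} (hQ : IsNoncyclicQuadrilateral Q)
    (i : Fin 4) :
    Complex.normSq (Q (i - 1) - nextQuadrilateral Q i) = (triadCircle Q i).radius ^ 2 := by
  rw [← dist_sq_eq_normSq, dist_comm]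
  exact congrArg (· ^ 2) (triadCircle_dist hQ i 0)

theorem normSq_succ_sub_eq_radius_sq {Q : Fin 4 → ℂ} (hQ : IsNoncyclicQuadrilateral Q)
    (i : Fin 4) :
    Complex.normSq (Q (i + 1) - nextQuadrilateral Q i) = (triadCircle Q i).radius ^ 2 := by
  rw [← dist_sq_eq_normSq, dist_comm]
  exact congrArg (· ^ 2) (triadCircle_dist hQ i 2)

theorem normSq_spiralSimilarity_sub (w c x y : ℂ) :
    Complex.normSq (spiralSimilarity w c x - spiralSimilarity w c y) =
      Complex.normSq c * Complex.normSq (x - y) := by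
  rw [← Complex.normSq_mul]
  congr 1
  simp only [spiralSimilarity]
  ring

/-- The construction commutes with spiral similarities. -/
theorem nextQuadrilateral_spiralSimilarity {Q Q' : Fin 4 → ℂ} {w c : ℂ}
    (hQ : IsNoncyclicQuadrilateral Q) (hQ' : IsNoncyclicQuadrilateral Q')
    (h : ∀ i, Q' i = spiralSimilarity w c (Q i)) (i : Fin 4) :
    nextQuadrilateral Q' i = spiralSimilarity w c (nextQuadrilateral Q i) := by
  refine (isEquidistant_nextQuadrilateral hQ' i).unique ?_
    ((affineIndependent_iff_signedArea_ne_zero _ _ _).1 (hQ'.1 i))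
  obtain ⟨h1, h2⟩ := isEquidistant_nextQuadrilateral hQ i
  rw [h, h, h]
  constructor
  · rw [normSq_spiralSimilarity_sub, normSq_spiralSimilarity_sub, h1]
  · rw [normSq_spiralSimilarity_sub, normSq_spiralSimilarity_sub, h2]

theorem generation_succ (Q : Fin 4 → ℂ) (n : ℕ) :
    generation Q (n + 1) = nextQuadrilateral (generation Q n) :=
  Function.iterate_succ_apply' _ _ _

theorem isNoncyclicQuadrilateral_generation {Q : Fin 4 → ℂ} (hQ : IsNoncyclicQuadrilateral Q)
    (n : ℕ) : IsNoncyclicQuadrilateral (generation Q n) := by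
  induction n with
  | zero => exact hQ
  | succ n ih => rw [generation_succ]; exact ih.next

theorem generationRatio_generation {Q : Fin 4 → ℂ} (hQ : IsNoncyclicQuadrilateral Q) (n : ℕ) :
    generationRatio (generation Q n) = generationRatio Q := by
  induction n with
  | zero => rfl
  | succ n ih =>
    rw [generation_succ, generationRatio_next (isNoncyclicQuadrilateral_generation hQ n), ih]

theorem IsNoncyclicQuadrilateral.ne {Q : Fin 4 → ℂ} (hQ : IsNoncyclicQuadrilateral Q) :
    Q 0 ≠ Q 1 := fun h =>
  ((isNoncyclicQuadrilateral_iff Q).1 hQ).snd (by rw [← h]; simp [signedArea])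

/-! ### Circles of similitude and spiral centers -/

theorem coe_mem_circleOfSimilitude {s t : EuclideanGeometry.Sphere ℂ} {z : ℂ} :
    (z : OnePoint ℂ) ∈ circleOfSimilitude s t ↔
      dist z s.center / dist z t.center = s.radius / t.radius := by
  simp [circleOfSimilitude]

theorem coe_mem_circleOfSimilitude_of_normSq {s t : EuclideanGeometry.Sphere ℂ} {z : ℂ} {κ : ℝ}
    (hκ : κ ≠ 0) (hs : 0 < s.radius) (ht : 0 < t.radius)
    (hsz : Complex.normSq (z - s.center) = κ * s.radius ^ 2)
    (htz : Complex.normSq (z - t.center) = κ * t.radius ^ 2) :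
    (z : OnePoint ℂ) ∈ circleOfSimilitude s t := by
  rw [coe_mem_circleOfSimilitude, ← sq_eq_sq₀ (by positivity) (by positivity), div_pow, div_pow,
    dist_sq_eq_normSq, dist_sq_eq_normSq, hsz, htz, mul_div_mul_left _ _ hκ]

theorem normSq_of_coe_mem_circleOfSimilitude {s t : EuclideanGeometry.Sphere ℂ} {z : ℂ}
    (hs : 0 < s.radius) (ht : 0 < t.radius) (h : (z : OnePoint ℂ) ∈ circleOfSimilitude s t) :
    Complex.normSq (z - t.center) =
      Complex.normSq (z - s.center) / s.radius ^ 2 * t.radius ^ 2 := by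
  rw [coe_mem_circleOfSimilitude] at h
  -- Division by zero gives 0, whereas the ratio of the radii is positive; hence the center of `t`
  -- is not on the locus.
  have hz : dist z t.center ≠ 0 := fun h0 => by
    rw [h0, div_zero] at h
    exact (div_pos hs ht).ne h
  rw [div_eq_div_iff hz ht.ne'] at h
  rw [← dist_sq_eq_normSq, ← dist_sq_eq_normSq]
  field_simp
  rw [← mul_pow, ← mul_pow, h, mul_comm]

theorem infty_mem_circleOfSimilitude {s t : EuclideanGeometry.Sphere ℂ} :
    OnePoint.infty ∈ circleOfSimilitude s t ↔ s.radius = t.radius := by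
  simp [circleOfSimilitude]

/-- The multiplier is forced by sending center to center. The common κ makes its modulus the ratio
of the radii, and κ ≠ 0 makes it defined and nonzero. -/
theorem isSpiralCenter_coe {s t : EuclideanGeometry.Sphere ℂ} {w : ℂ} {κ : ℝ} (hκ : κ ≠ 0)
    (hs : 0 < s.radius) (ht : 0 < t.radius)
    (hsw : Complex.normSq (w - s.center) = κ * s.radius ^ 2)
    (htw : Complex.normSq (w - t.center) = κ * t.radius ^ 2) :
    IsSpiralCenter w s t := by
  have hs0 : s.center - w ≠ 0 := fun h => by
    rw [← neg_sub, h, neg_zero, map_zero] at hsw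
    exact mul_ne_zero hκ (by positivity) hsw.symm
  have ht0 : t.center - w ≠ 0 := fun h => by
    rw [← neg_sub, h, neg_zero, map_zero] at htw
    exact mul_ne_zero hκ (by positivity) htw.symm
  have hc := div_ne_zero ht0 hs0
  have hcn : Complex.normSq ((t.center - w) / (s.center - w)) * s.radius ^ 2 = t.radius ^ 2 := by
    rw [map_div₀, ← Complex.normSq_neg, neg_sub, htw, ← Complex.normSq_neg (s.center - w), neg_sub,
      hsw]
    field_simp
  set c := (t.center - w) / (s.center - w) with hcdef
  have hct : spiralSimilarity w c s.center = t.center := by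
    simp only [spiralSimilarity, hcdef]
    field_simp
    ring
  have key : ∀ z, spiralSimilarity w c z ∈ t ↔ z ∈ s := fun z => by
    rw [EuclideanGeometry.mem_sphere, EuclideanGeometry.mem_sphere,
      ← sq_eq_sq₀ dist_nonneg ht.le, ← sq_eq_sq₀ dist_nonneg hs.le, dist_sq_eq_normSq,
      dist_sq_eq_normSq, ← hcn, ← hct, normSq_spiralSimilarity_sub]
    exact mul_right_inj' (by simpa using hc)
  refine Or.inl ⟨w, c, rfl, hc, ?_⟩
  ext y
  constructor
  · rintro ⟨z, hz, rfl⟩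
    exact (key z).2 hz
  · intro hy
    have hy' : spiralSimilarity w c (w + (y - w) / c) = y := by
      simp only [spiralSimilarity]
      field_simp
      ring
    exact ⟨w + (y - w) / c, (key _).1 (by rw [hy']; exact hy), hy'⟩

theorem isSpiralCenter_infty {s t : EuclideanGeometry.Sphere ℂ} (h : s.radius = t.radius) :
    IsSpiralCenter OnePoint.infty s t := by
  have key : ∀ z, z + (t.center - s.center) ∈ t ↔ z ∈ s := fun z => by
    rw [EuclideanGeometry.mem_sphere, EuclideanGeometry.mem_sphere, h, dist_eq_norm, dist_eq_norm]
    congr! 2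
    ring
  refine Or.inr ⟨rfl, t.center - s.center, ?_⟩
  ext y
  constructor
  · rintro ⟨z, hz, rfl⟩
    exact (key z).2 hz
  · intro hy
    exact ⟨y - (t.center - s.center), (key _).1 (by rw [sub_add_cancel]; exact hy),
      sub_add_cancel _ _⟩

/-- Two loci of points with prescribed ratios of distances to three noncollinear points have at most
two common points. -/
theorem eq_or_eq_of_normSq_proportional {o o' o'' A W P : ℂ} {ρ ρ' ρ'' α κ t : ℝ}
    (ho : signedArea o o' o'' ≠ 0) (hWA : κ ≠ α)
    (a : Complex.normSq (A - o) = α * ρ) (a' : Complex.normSq (A - o') = α * ρ')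
    (a'' : Complex.normSq (A - o'') = α * ρ'')
    (w : Complex.normSq (W - o) = κ * ρ) (w' : Complex.normSq (W - o') = κ * ρ')
    (w'' : Complex.normSq (W - o'') = κ * ρ'')
    (p : Complex.normSq (P - o) = t * ρ) (p' : Complex.normSq (P - o') = t * ρ')
    (p'' : Complex.normSq (P - o'') = t * ρ'') : P = A ∨ P = W := by
  have hka : κ - α ≠ 0 := sub_ne_zero.2 hWA
  have hz : (κ - α) * (P.re - A.re) = (t - α) * (W.re - A.re) ∧
      (κ - α) * (P.im - A.im) = (t - α) * (W.im - A.im) := by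
    simp only [signedArea, Complex.normSq_apply, Complex.sub_re, Complex.sub_im] at *
    -- Differences of the equations for o and o' are linear: 2⟨P - A, o' - o⟩ = (t - α)(ρ - ρ'), and
    -- likewise for W with κ. So (κ - α)(P - A) - (t - α)(W - A) is orthogonal to o' - o, and
    -- similarly to o'' - o; these two vectors span the plane.
    have h1 : ((κ - α) * (P.re - A.re) - (t - α) * (W.re - A.re)) * (o'.re - o.re) +
        ((κ - α) * (P.im - A.im) - (t - α) * (W.im - A.im)) * (o'.im - o.im) = 0 := by
      linear_combination ((κ - α) * (p - p' - a + a') - (t - α) * (w - w' - a + a')) / 2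
    have h2 : ((κ - α) * (P.re - A.re) - (t - α) * (W.re - A.re)) * (o''.re - o.re) +
        ((κ - α) * (P.im - A.im) - (t - α) * (W.im - A.im)) * (o''.im - o.im) = 0 := by
      linear_combination ((κ - α) * (p - p'' - a + a'') - (t - α) * (w - w'' - a + a'')) / 2
    constructor
    · refine sub_eq_zero.1 (mul_left_cancel₀ ho ?_)
      linear_combination (o''.im - o.im) * h1 - (o'.im - o.im) * h2
    · refine sub_eq_zero.1 (mul_left_cancel₀ ho ?_)
      linear_combination (o'.re - o.re) * h2 - (o''.re - o.re) * h1
  obtain ⟨hx, hy⟩ := hz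
  obtain ⟨l, hl⟩ : ∃ l, t - α = l * (κ - α) := ⟨(t - α) / (κ - α), (div_mul_cancel₀ _ hka).symm⟩
  have hx' : P.re - A.re = l * (W.re - A.re) :=
    mul_left_cancel₀ hka (by rw [hx, hl]; ring)
  have hy' : P.im - A.im = l * (W.im - A.im) :=
    mul_left_cancel₀ hka (by rw [hy, hl]; ring)
  -- P lies on the line AW with parameter l. The equation for o is quadratic in l with roots 0 and
  -- 1, given by A and W.
  have hq : l * (l - 1) * Complex.normSq (W - A) = 0 := by
    have ex : P.re = A.re + l * (W.re - A.re) := by linarith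
    have ey : P.im = A.im + l * (W.im - A.im) := by linarith
    simp only [Complex.normSq_apply, Complex.sub_re, Complex.sub_im] at a w p ⊢
    rw [ex, ey] at p
    linear_combination p - l * w - (1 - l) * a + ρ * hl
  rcases mul_eq_zero.1 hq with h | h
  · rcases mul_eq_zero.1 h with h | h
    · left
      apply Complex.ext <;> rw [← sub_eq_zero] <;> simp [hx', hy', h]
    · right
      rw [sub_eq_zero] at h
      rw [h, one_mul] at hx' hy'
      exact Complex.ext (sub_left_inj.1 hx') (sub_left_inj.1 hy')
  · have h : W = A := sub_eq_zero.1 (Complex.normSq_eq_zero.1 h)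
    left
    apply Complex.ext <;> rw [← sub_eq_zero] <;> simp [hx', hy', h]

/-! ### Ratio different from 1: a finite isoptic point -/

/-- The fixed point of z ↦ rz + v serves for the first generation; since the construction commutes
with similarities, the same center and ratio pass to each later one. -/
theorem exists_homothety_center {Q : Fin 4 → ℂ} (hQ : IsNoncyclicQuadrilateral Q)
    (hr : generationRatio Q ≠ 1) :
    ∃ w : ℂ, ∀ (n : ℕ) (i : Fin 4),
      generation Q (n + 2) i = spiralSimilarity w (generationRatio Q : ℂ) (generation Q n i) := by
  obtain ⟨v, hv⟩ := exists_next_next_eq hQ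
  have hr' : 1 - (generationRatio Q : ℂ) ≠ 0 :=
    sub_ne_zero.2 fun h => hr (by exact_mod_cast h.symm)
  refine ⟨v / (1 - generationRatio Q), fun n => ?_⟩
  induction n with
  | zero =>
    intro i
    refine (hv i).trans ?_
    simp only [spiralSimilarity, generation, Function.iterate_zero, id]
    field_simp
    ring
  | succ n ih =>
    intro i
    rw [generation_succ, generation_succ Q n]
    exact nextQuadrilateral_spiralSimilarity (isNoncyclicQuadrilateral_generation hQ n)
      (isNoncyclicQuadrilateral_generation hQ (n + 2)) ih i

/-- The center of the homothety sees all triad circles under the same angle. -/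
theorem normSq_homothety_center_sub {Q : Fin 4 → ℂ} (hQ : IsNoncyclicQuadrilateral Q)
    (hr : generationRatio Q ≠ 1) {w : ℂ} {i : Fin 4}
    (hw : nextQuadrilateral (nextQuadrilateral Q) i =
      spiralSimilarity w (generationRatio Q : ℂ) (Q i)) :
    Complex.normSq (w - nextQuadrilateral Q i) =
      generationRatio Q / (generationRatio Q - 1) * (triadCircle Q i).radius ^ 2 := by
  have h := next_next_isoptic_relation hQ i
  rw [← normSq_sub_eq_radius_sq hQ i]
  have hx := congrArg Complex.re hw
  have hy := congrArg Complex.im hw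
  have hr' : generationRatio Q - 1 ≠ 0 := sub_ne_zero.2 hr
  generalize generationRatio Q = r, nextQuadrilateral (nextQuadrilateral Q) i = p,
    nextQuadrilateral Q i = o, Q i = a at *
  simp only [spiralSimilarity, Complex.add_re, Complex.add_im, Complex.re_ofReal_mul,
    Complex.im_ofReal_mul, Complex.sub_re, Complex.sub_im, Complex.normSq_apply] at *
  refine mul_left_cancel₀ (pow_ne_zero 2 hr') ?_
  rw [hx, hy] at h
  have e : ∀ x, (r - 1) ^ 2 * (r / (r - 1) * x) = (r - 1) * r * x := fun x => by field_simp
  rw [e]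
  linear_combination h

theorem isSecondIntersection_iff_of_ne_one {Q : Fin 4 → ℂ} (hQ : IsNoncyclicQuadrilateral Q)
    {κ : ℝ} (hκ : κ ≠ 0) (hκ1 : κ ≠ 1) {w : ℂ}
    (hw : ∀ i, Complex.normSq (w - nextQuadrilateral Q i) = κ * (triadCircle Q i).radius ^ 2)
    (P : OnePoint ℂ) : IsSecondIntersection Q P ↔ P = w := by
  have hR := triadCircle_radius_pos hQ
  have h0 := normSq_sub_eq_radius_sq hQ 0
  have h1 : Complex.normSq (Q 0 - nextQuadrilateral Q 1) = _ := normSq_pred_sub_eq_radius_sq hQ 1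
  have h3 : Complex.normSq (Q 0 - nextQuadrilateral Q 3) = _ := normSq_succ_sub_eq_radius_sq hQ 3
  have hwQ : w ≠ Q 0 := fun h => by
    have := hw 0
    rw [h, h0] at this
    exact hκ1 (mul_right_cancel₀ (pow_ne_zero 2 (hR 0).ne') (this.symm.trans (one_mul _).symm))
  have ho := ((isNoncyclicQuadrilateral_iff _).1 hQ.next).fst
  rw [← signedArea_rotate] at ho
  constructor
  · rintro ⟨hP, hP1, hP3⟩
    induction P using OnePoint.rec with
    | infty =>
      exfalso
      rw [infty_mem_circleOfSimilitude] at hP1 hP3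
      -- If ∞ were common, the three radii would agree, and w and A would both be the circumcenter
      -- of the triangle of the three centers.
      refine hwQ (IsEquidistant.unique (a := nextQuadrilateral Q 0) (b := nextQuadrilateral Q 1)
        (c := nextQuadrilateral Q 3) ?_ ?_ ho)
      · exact ⟨by rw [hw, hw, hP1], by rw [hw, hw, ← hP1, hP3]⟩
      · exact ⟨by rw [h0, h1, hP1], by rw [h1, h3, ← hP1, hP3]⟩
    | coe z =>
      have hz1 := normSq_of_coe_mem_circleOfSimilitude (hR 0) (hR 1) hP1
      have hz3 := normSq_of_coe_mem_circleOfSimilitude (hR 0) (hR 3) hP3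
      have hz0 : Complex.normSq (z - nextQuadrilateral Q 0) =
          Complex.normSq (z - nextQuadrilateral Q 0) / (triadCircle Q 0).radius ^ 2 *
            (triadCircle Q 0).radius ^ 2 :=
        (div_mul_cancel₀ _ (pow_ne_zero 2 (hR 0).ne')).symm
      rcases eq_or_eq_of_normSq_proportional ho hκ1 (by rw [h0, one_mul]) (by rw [h1, one_mul])
        (by rw [h3, one_mul]) (hw 0) (hw 1) (hw 3) hz0 hz1 hz3 with h | h
      · exact absurd (congrArg _ h) hP
      · rw [h]
  · rintro rfl
    exact ⟨fun h => hwQ (OnePoint.coe_injective h),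
      coe_mem_circleOfSimilitude_of_normSq hκ (hR 0) (hR 1) (hw 0) (hw 1),
      coe_mem_circleOfSimilitude_of_normSq hκ (hR 0) (hR 3) (hw 0) (hw 3)⟩

/-! ### Ratio 1: the isoptic point at infinity -/

theorem next_next_eq_self {Q : Fin 4 → ℂ} (hQ : IsNoncyclicQuadrilateral Q)
    (hr : generationRatio Q = 1) : nextQuadrilateral (nextQuadrilateral Q) = Q := by
  ext1 i
  have h := next_next_isoptic_relation hQ i
  rw [hr] at h
  rw [← sub_eq_zero, ← Complex.normSq_eq_zero]
  simp only [Complex.normSq_apply, Complex.sub_re, Complex.sub_im] at h ⊢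
  linear_combination h

/-- As Q'' = Q, vertex and center exchange roles: both radii are the distance between them. -/
theorem triadCircle_next_radius_eq {Q : Fin 4 → ℂ} (hQ : IsNoncyclicQuadrilateral Q)
    (hr : generationRatio Q = 1) (i : Fin 4) :
    (triadCircle (nextQuadrilateral Q) i).radius = (triadCircle Q i).radius := by
  have h := normSq_sub_eq_radius_sq hQ.next i
  rw [next_next_eq_self hQ hr, ← Complex.normSq_neg, neg_sub, normSq_sub_eq_radius_sq hQ] at h
  exact (sq_eq_sq₀ (triadCircle_radius_pos hQ.next i).le (triadCircle_radius_pos hQ i).le).1 h.symm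

/-- The distance from the i-th vertex to the next center is a radius of circle i + 1 of Q and,
because Q'' = Q, also a radius of circle i of Q'. -/
theorem triadCircle_radius_succ_eq {Q : Fin 4 → ℂ} (hQ : IsNoncyclicQuadrilateral Q)
    (hr : generationRatio Q = 1) (i : Fin 4) :
    (triadCircle Q (i + 1)).radius = (triadCircle Q i).radius := by
  have h := normSq_succ_sub_eq_radius_sq hQ.next i
  have h' := normSq_pred_sub_eq_radius_sq hQ (i + 1)
  rw [add_sub_cancel_right] at h'
  rw [next_next_eq_self hQ hr, ← Complex.normSq_neg, neg_sub, h',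
    triadCircle_next_radius_eq hQ hr] at h
  exact (sq_eq_sq₀ (triadCircle_radius_pos hQ _).le (triadCircle_radius_pos hQ i).le).1 h

theorem triadCircle_generation_radius_eq {Q : Fin 4 → ℂ} (hQ : IsNoncyclicQuadrilateral Q)
    (hr : generationRatio Q = 1) (k : ℕ) (i : Fin 4) :
    (triadCircle (generation Q k) i).radius = (triadCircle Q 0).radius := by
  have hk : (triadCircle (generation Q k) i).radius = (triadCircle Q i).radius := by
    induction k with
    | zero => rfl
    | succ k ih =>
      rw [generation_succ, triadCircle_next_radius_eq (isNoncyclicQuadrilateral_generation hQ k)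
        ((generationRatio_generation hQ k).trans hr), ih]
  have h0 := triadCircle_radius_succ_eq hQ hr 0
  have h1 := triadCircle_radius_succ_eq hQ hr 1
  have h2 := triadCircle_radius_succ_eq hQ hr 2
  rw [hk]
  fin_cases i
  exacts [rfl, h0, h1.trans h0, h2.trans (h1.trans h0)]

theorem isSecondIntersection_iff_of_eq_one {Q : Fin 4 → ℂ} (hQ : IsNoncyclicQuadrilateral Q)
    (hr : generationRatio Q = 1) (P : OnePoint ℂ) :
    IsSecondIntersection Q P ↔ P = OnePoint.infty := by
  have hR := triadCircle_radius_pos hQ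
  have hRe := triadCircle_generation_radius_eq hQ hr 0
  change ∀ i, (triadCircle Q i).radius = _ at hRe
  constructor
  · rintro ⟨hP, hP1, hP3⟩
    induction P using OnePoint.rec with
    | infty => rfl
    | coe z =>
      have hz1 := normSq_of_coe_mem_circleOfSimilitude (hR 0) (hR 1) hP1
      have hz3 := normSq_of_coe_mem_circleOfSimilitude (hR 0) (hR 3) hP3
      rw [hRe 1, div_mul_cancel₀ _ (pow_ne_zero 2 (hR 0).ne')] at hz1
      rw [hRe 3, div_mul_cancel₀ _ (pow_ne_zero 2 (hR 0).ne')] at hz3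
      have he : IsEquidistant (nextQuadrilateral (nextQuadrilateral Q) 0) (nextQuadrilateral Q 3)
        (nextQuadrilateral Q 0) (nextQuadrilateral Q 1) := isEquidistant_nextQuadrilateral hQ.next 0
      rw [next_next_eq_self hQ hr] at he
      -- With equal radii both loci are perpendicular bisectors. Their only finite common point is
      -- the circumcenter of the three centers, a vertex of Q'', which is A.
      exact absurd (congrArg _ (IsEquidistant.unique ⟨hz3, hz1.symm⟩ he
        ((isNoncyclicQuadrilateral_iff _).1 hQ.next).fst)) hP
  · rintro rfl
    exact ⟨OnePoint.infty_ne_coe _, infty_mem_circleOfSimilitude.2 (hRe 1).symm,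
      infty_mem_circleOfSimilitude.2 (hRe 3).symm⟩

/-! ### The main theorem -/

theorem mainTheorem8 (Q : Fin 4 → ℂ) (hQ : IsNoncyclicQuadrilateral Q) :
    (∀ n : ℕ, IsNoncyclicQuadrilateral (generation Q n)) ∧
    ∃ W : OnePoint ℂ,
      (∀ P : OnePoint ℂ, IsSecondIntersection Q P ↔ P = W) ∧
      (∀ w : ℂ, W = (w : OnePoint ℂ) ↔
        ∃ r : ℝ, r ≠ 1 ∧ ∀ (n : ℕ) (i : Fin 4),
          generation Q (n + 2) i = spiralSimilarity w (r : ℂ) (generation Q n i)) ∧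
      (∀ (k l : ℕ) (i j : Fin 4),
        W ∈ circleOfSimilitude (triadCircle (generation Q k) i) (triadCircle (generation Q l) j) ∧
        IsSpiralCenter W (triadCircle (generation Q k) i) (triadCircle (generation Q l) j)) := by
  have hG := isNoncyclicQuadrilateral_generation hQ
  have hR := fun k => triadCircle_radius_pos (hG k)
  have hne := IsNoncyclicQuadrilateral.ne hQ
  refine ⟨hG, ?_⟩
  by_cases hr : generationRatio Q = 1
  · have hRe := triadCircle_generation_radius_eq hQ hr
    refine ⟨OnePoint.infty, isSecondIntersection_iff_of_eq_one hQ hr, fun w => ?_,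
      fun k l i j => ⟨infty_mem_circleOfSimilitude.2 ((hRe k i).trans (hRe l j).symm),
        isSpiralCenter_infty ((hRe k i).trans (hRe l j).symm)⟩⟩
    refine iff_of_false (OnePoint.infty_ne_coe w) ?_
    rintro ⟨r, hr1, h⟩
    -- Since Q'' = Q, a homothety with ratio other than 1 would fix every vertex, so all vertices
    -- would coincide with its center.
    have hw : ∀ i, Q i = w := fun i => by
      have hi := (congrFun (next_next_eq_self hQ hr) i).symm.trans (h 0 i)
      simp only [spiralSimilarity, generation, Function.iterate_zero, id] at hi
      have hr1' : (r : ℂ) - 1 ≠ 0 := sub_ne_zero.2 fun h => hr1 (by exact_mod_cast h)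
      refine sub_eq_zero.1 ((mul_eq_zero.1 (?_ : ((r : ℂ) - 1) * (Q i - w) = 0)).resolve_left hr1')
      linear_combination -hi
    exact hne ((hw 0).trans (hw 1).symm)
  · obtain ⟨w, hw⟩ := exists_homothety_center hQ hr
    have hr0 := hQ.generationRatio_ne_zero
    have hr1 : generationRatio Q - 1 ≠ 0 := sub_ne_zero.2 hr
    have hκ : generationRatio Q / (generationRatio Q - 1) ≠ 0 := div_ne_zero hr0 hr1
    have hκ1 : generationRatio Q / (generationRatio Q - 1) ≠ 1 := fun h => by
      rw [div_eq_one_iff_eq hr1] at h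
      linarith
    have hK : ∀ k i, Complex.normSq (w - nextQuadrilateral (generation Q k) i) =
        generationRatio Q / (generationRatio Q - 1) *
          (triadCircle (generation Q k) i).radius ^ 2 := fun k i => by
      have h := normSq_homothety_center_sub (hG k) (w := w) (i := i)
      rw [generationRatio_generation hQ] at h
      exact h hr (by rw [← hw, generation_succ, generation_succ])
    refine ⟨w, isSecondIntersection_iff_of_ne_one hQ hκ hκ1 (hK 0), fun w' => ?_,
      fun k l i j => ⟨coe_mem_circleOfSimilitude_of_normSq hκ (hR k i) (hR l j) (hK k i) (hK l j),
        isSpiralCenter_coe hκ (hR k i) (hR l j) (hK k i) (hK l j)⟩⟩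
    constructor
    · intro h
      rw [← OnePoint.coe_injective h]
      exact ⟨_, hr, hw⟩
    · rintro ⟨r, hr1, h⟩
      have e0 := (hw 0 0).symm.trans (h 0 0)
      have e1 := (hw 0 1).symm.trans (h 0 1)
      simp only [spiralSimilarity, generation, Function.iterate_zero, id] at e0 e1
      -- Comparing the images of the side AB, which has nonzero length, identifies the ratios; a
      -- homothety of ratio other than 1 then determines its center.
      have hrr : (generationRatio Q : ℂ) = r := by
        refine mul_right_cancel₀ (sub_ne_zero.2 hne) ?_
        linear_combination e0 - e1
      rw [hrr] at e0
      have hr1' : (r : ℂ) - 1 ≠ 0 := sub_ne_zero.2 fun h => hr1 (by exact_mod_cast h)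
      congr 1
      refine mul_left_cancel₀ hr1' ?_
      linear_combination -e0
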